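/- Let $d\in\mathbb{N}$, let $U:\mathbb{R}^d\to\mathbb{R}$ be continuously differentiable, and let $T_\gamma:\mathbb{R}^d\to\mathbb{R}^d$, $\gamma>0$, be a family of drift functions. Let $\|\cdot\|$ be the Euclidean norm. Assume the following. (H1) There exist $\ell,L\ge 0$ such that $\|\nabla U(x)-\nabla U(y)\|\le L\,(1+\|x\|^\ell+\|y\|^\ell)\,\|x-y\|$ for all $x,y\in\mathbb{R}^d$. (A1) For every $\gamma>0$, $T_\gamma$ is continuous, and there exist $\alpha\ge 0$ and $C_\alpha<\infty$ such that $\|T_\gamma(x)-\nabla U(x)\|\le \gamma\, C_\alpha\,(1+\|x\|^\alpha)$ for all $\gamma>0$ and $x\in\mathbb{R}^d$. (A2) For every $\gamma>0$, $\displaystyle\liminf_{\|x\|\to+\infty}\Big(\Big\langle \frac{x}{\|x\|},T_\gamma(x)\Big\rangle-\frac{\gamma}{2\|x\|}\|T_\gamma(x)\|^2\Big)>0$. For $\gamma>0$ let $R_\gamma$ be the Markov kernel of the tamed Euler scheme, $$R_\gamma(x,A)=(2\pi)^{-d/2}\int_{\mathbb{R}^d}\mathbf{1}_A\big(x-\gamma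 T_\gamma(x)+\sqrt{2\gamma}\,z\big)\,e^{-\|z\|^2/2}\,dz ,$$ and for $a>0$ let $V_a(x)=\exp\big(a(1+\|x\|^2)^{1/2}\big)$. For a measurable $V:\mathbb{R}^d\to[1,\infty)$ write $\|\mu-\nu\|_V=\sup_{|f|\le V}|\mu(f)-\nu(f)|$, where the supremum is over measurable functions $f$ that are integrable for $\mu$ and $\nu$. Then for every $\gamma>0$ there exist $M,a,b>0$ such that for all $x\in\mathbb{R}^d$ the function $V_a$ is $R_\gamma(x,\cdot)$-integrable and $$R_\gamma V_a(x)=\int V_a(y)\,R_\gamma(x,dy)\le e^{-a^2\gamma}V_a(x)+\gamma\, b\,\mathbf{1}_{\overline{B}(0,M)}(x),$$ where $\overline{B}(0,M)$ is the closed ball. In addition, for this $a$, $R_\gamma$ has a unique invariant probability measure $\pi_\gamma$, and $R_\gamma$ is $V_a$-geometrically ergodic with respect to $\pi_\gamma$: $\pi_\gamma(V_a)<\infty$ and there exist $C\ge 0$ and $\rho\in[0,1)$ such that for all $n\in\mathbb{N}$ and all probability measures $\mu_0,\nu_0$ on $\mathbb{R}^d$ with $\mu_0(V_a)+\nu_0(V_a)<\infty$,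 $$\|\mu_0R_\gamma^n-\nu_0R_\gamma^n\|_{V_a}\le C\rho^n\|\mu_0-\nu_0\|_{V_a},\qquad \|\mu_0R_\gamma^n-\pi_\gamma\|_{V_a}\le C\rho^n\mu_0(V_a).$$ In particular $\|R_\gamma^n(x,\cdot)-\pi_\gamma\|_{V_a}\le C\rho^nV_a(x)$ for all $x\in\mathbb{R}^d$ and $n\in\mathbb{N}$. -/

import Mathlib

open MeasureTheory ProbabilityTheory Filter

noncomputable section

namespace TamedEuler

/-- The gradient of `U` is locally Lipschitz with a polynomially growing constant. -/
def GradLocLipschitz {d : ℕ} (U : EuclideanSpace ℝ (Fin d) → ℝ) : Prop :=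
  ∃ l L : ℝ, 0 ≤ l ∧ 0 ≤ L ∧ ∀ x y : EuclideanSpace ℝ (Fin d),
    ‖gradient U x - gradient U y‖ ≤ L * (1 + ‖x‖ ^ l + ‖y‖ ^ l) * ‖x - y‖

/-- The family `T γ`, `γ > 0`, consists of continuous drifts that approximate `∇U`
up to a polynomial times `γ`; the constants do not depend on `γ`. -/
def DriftCloseToGrad {d : ℕ} (U : EuclideanSpace ℝ (Fin d) → ℝ)
    (T : ℝ → EuclideanSpace ℝ (Fin d) → EuclideanSpace ℝ (Fin d)) : Prop :=
  (∀ γ : ℝ, 0 < γ → Continuous (T γ)) ∧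
  ∃ α C : ℝ, 0 ≤ α ∧ ∀ γ : ℝ, 0 < γ → ∀ x : EuclideanSpace ℝ (Fin d),
    ‖T γ x - gradient U x‖ ≤ γ * C * (1 + ‖x‖ ^ α)

/-- For all `γ > 0`,
`liminf_{‖x‖ → ∞} ⟪x / ‖x‖, T γ x⟫ - γ / (2 ‖x‖) * ‖T γ x‖ ^ 2 > 0`.
The lower limit is taken in the extended reals. -/
def DriftErgodic {d : ℕ}
    (T : ℝ → EuclideanSpace ℝ (Fin d) → EuclideanSpace ℝ (Fin d)) : Prop :=
  ∀ γ : ℝ, 0 < γ →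
    (0 : EReal) < liminf
      (fun x : EuclideanSpace ℝ (Fin d) =>
        ((inner ℝ (‖x‖⁻¹ • x) (T γ x) - γ / (2 * ‖x‖) * ‖T γ x‖ ^ 2 : ℝ) : EReal))
      (comap norm atTop)

/-- The Lyapunov function `V_a(x) = exp (a (1 + ‖x‖²)^(1/2))`. -/
def lyapunov {d : ℕ} (a : ℝ) (x : EuclideanSpace ℝ (Fin d)) : ℝ :=
  Real.exp (a * Real.sqrt (1 + ‖x‖ ^ 2))

/-- The standard Gaussian measure on `ℝ^d`, given by its Lebesgue density
`(2π)^(-d/2) exp (-‖z‖² / 2)`. -/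
def gaussian (d : ℕ) : Measure (EuclideanSpace ℝ (Fin d)) :=
  volume.withDensity fun z =>
    ENNReal.ofReal ((2 * Real.pi) ^ (-(d : ℝ) / 2) * Real.exp (-‖z‖ ^ 2 / 2))

instance sFinite_gaussian (d : ℕ) : SFinite (gaussian d) := by
  unfold gaussian
  infer_instance

/-- The kernel of the Euler scheme with step `γ` and drift `H`: `R(x, ·)` is the law of
`x - γ H(x) + √(2γ) Z` with `Z` a standard Gaussian vector. -/
def eulerKernel {d : ℕ} (γ : ℝ) (H : EuclideanSpace ℝ (Fin d) → EuclideanSpace ℝ (Fin d))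
    (hH : Measurable H) : Kernel (EuclideanSpace ℝ (Fin d)) (EuclideanSpace ℝ (Fin d)) where
  toFun x := (gaussian d).map fun z => x - γ • H x + Real.sqrt (2 * γ) • z
  measurable' := by
    refine Measure.measurable_of_measurable_coe _ fun A hA => ?_
    have hp : Measurable fun p : EuclideanSpace ℝ (Fin d) × EuclideanSpace ℝ (Fin d) =>
        p.1 - γ • H p.1 + Real.sqrt (2 * γ) • p.2 := by fun_prop
    have key := measurable_measure_prodMk_left (ν := gaussian d) (hp hA)
    have h : (fun x => (gaussian d).map
        (fun z => x - γ • H x + Real.sqrt (2 * γ) • z) A) =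
        fun x => gaussian d (Prod.mk x ⁻¹'
          ((fun p : EuclideanSpace ℝ (Fin d) × EuclideanSpace ℝ (Fin d) =>
            p.1 - γ • H p.1 + Real.sqrt (2 * γ) • p.2) ⁻¹' A)) := by
      funext x
      rw [Measure.map_apply (by fun_prop) hA]
      rfl
    rw [h]
    exact key

/-- The `V`-total variation distance `sup_{|f| ≤ V} |μ(f) - ν(f)|`, over measurable functions
`f` for which both integrals make sense. -/
def vDist {E : Type*} [MeasurableSpace E] (V : E → ℝ) (μ ν : Measure E) : ENNReal :=
  ⨆ f : {f : E → ℝ // Measurable f ∧ (∀ x, |f x| ≤ V x) ∧ Integrable f μ ∧ Integrable f ν},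
    ENNReal.ofReal |∫ x, f.1 x ∂μ - ∫ x, f.1 x ∂ν|

/-- `R` is `V`-geometrically ergodic with respect to `π`: `π` is invariant, `π(V) < ∞`, and
there are `C ≥ 0`, `ρ ∈ [0, 1)` such that for all `n` and all probability measures `μ₀`, `ν₀`
that integrate `V`, one has `‖μ₀Rⁿ - ν₀Rⁿ‖_V ≤ C ρⁿ ‖μ₀ - ν₀‖_V` and
`‖μ₀Rⁿ - π‖_V ≤ C ρⁿ μ₀(V)`. The second bound with `μ₀ = δ_x` is
`‖Rⁿ(x, ·) - π‖_V ≤ C ρⁿ V(x)`. -/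
def VGeometricallyErgodic {E : Type*} [MeasurableSpace E] (V : E → ℝ) (R : Kernel E E)
    (π : Measure E) : Prop :=
  R.Invariant π ∧ Integrable V π ∧
  ∃ C ρ : ℝ, 0 ≤ C ∧ 0 ≤ ρ ∧ ρ < 1 ∧ ∀ n : ℕ, ∀ μ₀ : Measure E, IsProbabilityMeasure μ₀ →
    Integrable V μ₀ →
      (∀ ν₀ : Measure E, IsProbabilityMeasure ν₀ → Integrable V ν₀ →
        vDist V (μ₀.bind ⇑(R ^ n)) (ν₀.bind ⇑(R ^ n)) ≤
          ENNReal.ofReal (C * ρ ^ n) * vDist V μ₀ ν₀) ∧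
      vDist V (μ₀.bind ⇑(R ^ n)) π ≤ ENNReal.ofReal (C * ρ ^ n * ∫ x, V x ∂μ₀)

end TamedEuler

end

namespace TamedEuler

open scoped Topology ENNReal

/-! ### Weighted total variation and the oscillation seminorm -/

section Harris

variable {E : Type*} [MeasurableSpace E]

/-! The proof is Harris' theorem, in the style of Hairer and Mattingly, applied to the Euler kernel.

Drift (`exists_lyapunov_drift`): far out, (A2) gives `‖x - γ T x‖² ≤ ‖x‖² - 2γδ‖x‖`. Bounding the
square root in `V_a` by a tangent line makes the exponent quadratic in the Gaussian variable, so the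
expectation is explicit. With `a = δ/4` the one-step factor tends to `exp(-3a²γ) < exp(-a²γ)`; on a
ball continuity suffices.

Minorization (`exists_le_map_gaussian`): sublevel sets of `V_a` are bounded, so the Gaussian laws
started there dominate a common multiple of Lebesgue measure on the unit ball.

Together these make `R` contract oscillations measured with the weight `1 + βV`
(`exists_oscillation_contraction`), hence by duality the weighted distance. Iterates from a point
are then Cauchy uniformly over sets and their limit is invariant. Uniqueness follows by contraction
once every invariant probability is known to integrate `V` (`integrable_of_invariant`). -/

theorem integral_bind_kernel {f : E → ℝ} {μ : Measure E} {R : Kernel E E}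
    (hf : Integrable f (μ.bind ⇑R)) : ∫ x, f x ∂(μ.bind ⇑R) = ∫ x, ∫ y, f y ∂(R x) ∂μ := by
  rw [Measure.comp_eq_comp_const_apply] at hf ⊢
  rw [Kernel.integral_comp hf, Kernel.const_apply]

/-- A geometric drift condition for `V`, together with a minorization of the kernel on all
sublevel sets of `V`. -/
structure HarrisCondition (V : E → ℝ) (R : Kernel E E) (l K : ℝ) : Prop where
  measurable : Measurable V
  one_le : ∀ x, 1 ≤ V x
  rate_nonneg : 0 ≤ l
  rate_lt_one : l < 1
  const_nonneg : 0 ≤ K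
  integrable : ∀ x, Integrable V (R x)
  drift : ∀ x, ∫ y, V y ∂(R x) ≤ l * V x + K
  minorization : ∀ r : ℝ, ∃ η : Measure E, IsFiniteMeasure η ∧ η ≠ 0 ∧ ∀ x, V x ≤ r → η ≤ R x

theorem vDist_le_const_mul {V W : E → ℝ} {c : ℝ} (hc : 0 < c) (hVW : ∀ x, V x ≤ c * W x)
    (μ ν : Measure E) : vDist V μ ν ≤ ENNReal.ofReal c * vDist W μ ν := by
  refine iSup_le fun ⟨f, hf, hfV, hfμ, hfν⟩ => ?_
  have hW : ∀ x, |c⁻¹ * f x| ≤ W x := fun x => by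
    rw [abs_mul, abs_of_pos (inv_pos.2 hc), inv_mul_le_iff₀ hc]
    exact (hfV x).trans (hVW x)
  have key := le_iSup (fun f : {f : E → ℝ // Measurable f ∧ (∀ x, |f x| ≤ W x) ∧
    Integrable f μ ∧ Integrable f ν} => ENNReal.ofReal |∫ x, f.1 x ∂μ - ∫ x, f.1 x ∂ν|)
    ⟨fun x => c⁻¹ * f x, hf.const_mul _, hW, hfμ.const_mul _, hfν.const_mul _⟩
  refine le_trans ?_ (mul_le_mul_right key (ENNReal.ofReal c))
  rw [← ENNReal.ofReal_mul hc.le]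
  refine ENNReal.ofReal_le_ofReal (le_of_eq ?_)
  simp only [integral_const_mul]
  rw [← mul_sub, abs_mul, abs_of_pos (inv_pos.2 hc), mul_inv_cancel_left₀ hc.ne']

theorem vDist_le_integral_add {V : E → ℝ} {μ ν : Measure E} (hμ : Integrable V μ)
    (hν : Integrable V ν) : vDist V μ ν ≤ ENNReal.ofReal (∫ x, V x ∂μ + ∫ x, V x ∂ν) := by
  refine iSup_le fun ⟨f, _, hfV, hfμ, hfν⟩ => ENNReal.ofReal_le_ofReal ?_
  have h : ∀ κ : Measure E, Integrable V κ → |∫ x, f x ∂κ| ≤ ∫ x, V x ∂κ := fun κ hκ =>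
    norm_integral_le_of_norm_le (f := f) hκ (ae_of_all _ hfV)
  exact (abs_sub _ _).trans (add_le_add (h μ hμ) (h ν hν))

theorem ofReal_abs_measureReal_sub_le_vDist {V : E → ℝ} (hV : ∀ x, 1 ≤ V x) (μ ν : Measure E)
    [IsProbabilityMeasure μ] [IsProbabilityMeasure ν] {A : Set E} (hA : MeasurableSet A) :
    ENNReal.ofReal |μ.real A - ν.real A| ≤ vDist V μ ν := by
  have hle : ∀ x, |A.indicator (fun _ => (1 : ℝ)) x| ≤ V x := fun x => by
    refine le_trans ?_ (hV x)
    by_cases hx : x ∈ A <;> simp [hx]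
  have key := le_iSup (fun f : {f : E → ℝ // Measurable f ∧ (∀ x, |f x| ≤ V x) ∧
    Integrable f μ ∧ Integrable f ν} => ENNReal.ofReal |∫ x, f.1 x ∂μ - ∫ x, f.1 x ∂ν|)
    ⟨A.indicator fun _ => 1, measurable_const.indicator hA, hle,
      (integrable_const _).indicator hA, (integrable_const _).indicator hA⟩
  simp only [integral_indicator_const _ hA, smul_eq_mul, mul_one] at key
  exact key

/-- A function whose oscillation is controlled by `W` is, up to a constant, bounded by `W`. -/
theorem exists_forall_abs_sub_le {E : Type*} [Nonempty E] {g W : E → ℝ}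
    (h : ∀ x y, |g x - g y| ≤ W x + W y) : ∃ c, ∀ x, |g x - c| ≤ W x := by
  have hle : ∀ x y, g x - W x ≤ g y + W y := fun x y => by
    have := (le_abs_self _).trans (h x y)
    linarith
  -- Any number between `sup (g - W)` and `inf (g + W)` would do; the hypothesis says exactly that
  -- these are ordered.
  refine ⟨⨆ x, (g x - W x), fun x => abs_le.2 ⟨?_, ?_⟩⟩
  · have := ciSup_le fun y => hle y x
    linarith
  · have hb : BddAbove (Set.range fun y => g y - W y) :=
      ⟨g x + W x, by rintro _ ⟨y, rfl⟩; exact hle y x⟩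
    have := le_ciSup hb x
    linarith

/-- If `R` contracts the oscillation seminorm of weight `W`, it contracts `vDist W`. -/
theorem vDist_bind_le_of_oscillation [Nonempty E] {W : E → ℝ} {R : Kernel E E}
    {ρ : ℝ} (hρ : 0 < ρ)
    (h : ∀ f : E → ℝ, Measurable f → (∀ x, |f x| ≤ W x) → ∀ x y,
      |∫ z, f z ∂(R x) - ∫ z, f z ∂(R y)| ≤ ρ * W x + ρ * W y)
    (μ ν : Measure E) [IsProbabilityMeasure μ] [IsProbabilityMeasure ν] :
    vDist W (μ.bind ⇑R) (ν.bind ⇑R) ≤ ENNReal.ofReal ρ * vDist W μ ν := by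
  refine iSup_le fun ⟨f, hf, hfW, hfμ, hfν⟩ => ?_
  -- Centring turns the oscillation bound on `R f` into a pointwise one, and the constant cancels
  -- between two probability measures.
  obtain ⟨c, hc⟩ := exists_forall_abs_sub_le (h f hf hfW)
  set g : E → ℝ := fun x => ∫ z, f z ∂(R x) with hg
  have hgm : Measurable g := hf.stronglyMeasurable.integral_kernel.measurable
  have hgi : ∀ κ : Measure E, Integrable f (κ.bind ⇑R) → Integrable g κ := fun κ hκ =>
    (Measure.integrable_integral_norm_of_integrable_comp hκ).mono' hgm.aestronglyMeasurable
      (ae_of_all _ fun x => norm_integral_le_integral_norm _)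
  have hgint : ∀ κ : Measure E, Integrable f (κ.bind ⇑R) →
      ∫ x, f x ∂(κ.bind ⇑R) = ∫ x, g x ∂κ := fun κ hκ => integral_bind_kernel hκ
  have hW : ∀ x, |ρ⁻¹ * (g x - c)| ≤ W x := fun x => by
    rw [abs_mul, abs_of_pos (inv_pos.2 hρ), inv_mul_le_iff₀ hρ]
    exact hc x
  have hi : ∀ κ : Measure E, IsProbabilityMeasure κ → Integrable f (κ.bind ⇑R) →
      Integrable (fun x => ρ⁻¹ * (g x - c)) κ := fun κ _ hκ =>
    ((hgi κ hκ).sub (integrable_const c)).const_mul _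
  have key := le_iSup (fun f : {f : E → ℝ // Measurable f ∧ (∀ x, |f x| ≤ W x) ∧
    Integrable f μ ∧ Integrable f ν} => ENNReal.ofReal |∫ x, f.1 x ∂μ - ∫ x, f.1 x ∂ν|)
    ⟨fun x => ρ⁻¹ * (g x - c), (hgm.sub_const c).const_mul _, hW, hi μ ‹_› hfμ, hi ν ‹_› hfν⟩
  refine le_trans ?_ (mul_le_mul_right key (ENNReal.ofReal ρ))
  rw [← ENNReal.ofReal_mul hρ.le]
  refine ENNReal.ofReal_le_ofReal (le_of_eq ?_)
  simp only [integral_const_mul]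
  rw [integral_sub (hgi μ hfμ) (integrable_const c), integral_sub (hgi ν hfν) (integrable_const c),
    hgint μ hfμ, hgint ν hfν, ← mul_sub, abs_mul, abs_of_pos (inv_pos.2 hρ),
    mul_inv_cancel_left₀ hρ.ne']
  simp

/-! ### Moments of the iterates and geometric contraction -/

namespace HarrisCondition

variable {V : E → ℝ} {R : Kernel E E} {l K : ℝ}

theorem integrable_bind [IsMarkovKernel R] (h : HarrisCondition V R l K) {μ : Measure E}
    [IsProbabilityMeasure μ] (hμ : Integrable V μ) :
    Integrable V (μ.bind ⇑R) ∧ ∫ x, V x ∂(μ.bind ⇑R) ≤ l * ∫ x, V x ∂μ + K := by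
  have hint : Integrable V (μ.bind ⇑R) := by
    rw [Measure.integrable_comp_iff h.measurable.aestronglyMeasurable]
    refine ⟨ae_of_all _ h.integrable, ?_⟩
    refine ((hμ.const_mul l).add (integrable_const K)).mono'
      h.measurable.norm.stronglyMeasurable.integral_kernel.aestronglyMeasurable
      (ae_of_all _ fun x => ?_)
    have hn : ∀ y, ‖V y‖ = V y := fun y =>
      Real.norm_of_nonneg (zero_le_one.trans (h.one_le y))
    simp only [hn]
    rw [Real.norm_of_nonneg (integral_nonneg fun y => zero_le_one.trans (h.one_le y))]
    exact h.drift x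
  refine ⟨hint, ?_⟩
  rw [integral_bind_kernel hint]
  have hm : Integrable (fun x => ∫ y, V y ∂(R x)) μ :=
    (Measure.integrable_integral_norm_of_integrable_comp hint).mono'
      h.measurable.stronglyMeasurable.integral_kernel.aestronglyMeasurable
      (ae_of_all _ fun x => norm_integral_le_integral_norm _)
  refine (integral_mono hm ((hμ.const_mul l).add (integrable_const K)) h.drift).trans
    (le_of_eq ?_)
  simp only [Pi.add_apply]
  rw [integral_add (hμ.const_mul l) (integrable_const K), integral_const_mul]
  simp

theorem bind_pow_succ (R : Kernel E E) (μ : Measure E) (n : ℕ) :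
    μ.bind ⇑(R ^ (n + 1)) = (μ.bind ⇑(R ^ n)).bind ⇑R := by
  rw [Measure.comp_assoc, pow_succ']
  rfl

theorem bind_pow_add (R : Kernel E E) (μ : Measure E) (m n : ℕ) :
    μ.bind ⇑(R ^ (n + m)) = (μ.bind ⇑(R ^ m)).bind ⇑(R ^ n) := by
  rw [Measure.comp_assoc, Kernel.pow_add]

theorem bind_pow_zero (R : Kernel E E) (μ : Measure E) : μ.bind ⇑(R ^ 0) = μ := by
  rw [pow_zero]
  exact Measure.id_comp

theorem isProbabilityMeasure_bind_pow (R : Kernel E E) [IsMarkovKernel R] (μ : Measure E)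
    [IsProbabilityMeasure μ] (n : ℕ) : IsProbabilityMeasure (μ.bind ⇑(R ^ n)) := by
  induction n with
  | zero => rwa [bind_pow_zero]
  | succ n ih => rw [bind_pow_succ]; infer_instance

/-- The additive constant is the fixed point of `t ↦ l t + K`, so it reproduces itself at each step.
-/
theorem integrable_bind_pow [IsMarkovKernel R] (h : HarrisCondition V R l K) {μ : Measure E}
    [IsProbabilityMeasure μ] (hμ : Integrable V μ) (n : ℕ) :
    Integrable V (μ.bind ⇑(R ^ n)) ∧
      ∫ x, V x ∂(μ.bind ⇑(R ^ n)) ≤ l ^ n * ∫ x, V x ∂μ + K / (1 - l) := by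
  have h1 : 0 < 1 - l := sub_pos.2 h.rate_lt_one
  induction n with
  | zero =>
    rw [bind_pow_zero]
    exact ⟨hμ, by have := div_nonneg h.const_nonneg h1.le; simpa using this⟩
  | succ n ih =>
    have := isProbabilityMeasure_bind_pow R μ n
    obtain ⟨hi, hb⟩ := h.integrable_bind ih.1
    rw [bind_pow_succ]
    refine ⟨hi, hb.trans ?_⟩
    have h2 := mul_le_mul_of_nonneg_left ih.2 h.rate_nonneg
    have h3 : l * (K / (1 - l)) + K = K / (1 - l) := by field_simp; ring
    rw [pow_succ']
    linarith

/-- If `V x + V y` is large, the drift alone contracts; if it is small, both points lie in a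
minorized sublevel set and `η` cancels. A small `β` keeps the drift constant from undoing the gain
in the second case. -/
theorem exists_oscillation_contraction [IsMarkovKernel R] (h : HarrisCondition V R l K) :
    ∃ β ρ : ℝ, 0 < β ∧ 0 < ρ ∧ ρ < 1 ∧ ∀ f : E → ℝ, Measurable f →
      (∀ x, |f x| ≤ 1 + β * V x) → ∀ x y,
      |∫ z, f z ∂(R x) - ∫ z, f z ∂(R y)| ≤ ρ * (1 + β * V x) + ρ * (1 + β * V y) := by
  obtain ⟨hVm, hV, hl0, hl1, hK, hVi, hdr, hmin⟩ := h
  -- For `V x + V y ≥ r`, raising the rate from `l` to `l'` absorbs both constants `K`.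
  set l' := (l + 1) / 2 with hl'
  set r := 4 * (K + 1) / (1 - l) with hr
  have h1l : 0 < 1 - l := sub_pos.2 hl1
  have hr0 : 0 < r := by positivity
  have hr2 : (l' - l) * r = 2 * (K + 1) := by rw [hl', hr]; field_simp; ring
  obtain ⟨η, hηf, hη0, hη⟩ := hmin r
  -- The mass of `η` is unconstrained if the sublevel set is empty; the cap still keeps `ρ` at least
  -- `1/2`.
  set ε := min 1 (η.real Set.univ) with hε
  have hη1 : 0 < η.real Set.univ := by
    rw [measureReal_def, ENNReal.toReal_pos_iff]
    exact ⟨by simpa [pos_iff_ne_zero] using hη0, measure_lt_top _ _⟩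
  have hε0 : 0 < ε := lt_min one_pos hη1
  have hε1 : ε ≤ 1 := min_le_left _ _
  set β := ε / (2 * (K + 1)) with hβ
  have hβ0 : 0 < β := by positivity
  have hβK : 2 * (β * K) ≤ ε := by
    rw [hβ]
    have : 2 * (ε / (2 * (K + 1)) * K) = ε * (K / (K + 1)) := by field_simp
    rw [this]
    exact mul_le_of_le_one_right hε0.le ((div_le_one (by positivity)).2 (by linarith))
  -- The first two terms serve the near case, where `2 - 2ε + 2βK ≤ 2 - ε`. The third is the
  -- far-case ratio at `V x + V y = r`; since `l' ≤ ρ`, the bound persists beyond `r`.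
  set ρ := max (max (1 - ε / 2) l) ((2 + β * l' * r) / (2 + β * r)) with hρ
  have hρ1 : 1 - ε / 2 ≤ ρ := (le_max_left _ _).trans (le_max_left _ _)
  have hρ2 : l ≤ ρ := (le_max_right _ _).trans (le_max_left _ _)
  have hρ3 : 2 + β * l' * r ≤ ρ * (2 + β * r) :=
    (div_le_iff₀ (by positivity)).1 (le_max_right _ _)
  have hl'1 : l' < 1 := by rw [hl']; linarith
  have hρ4 : ρ < 1 := by
    refine max_lt (max_lt (by linarith) hl1) ?_
    rw [div_lt_one (by positivity)]
    have := mul_lt_mul_of_pos_right hl'1 (mul_pos hβ0 hr0)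
    linarith
  have hρl' : l' ≤ ρ := by
    have h1 : 2 * (1 - ρ) ≤ (ρ - l') * (β * r) := by linarith
    have h2 : 0 ≤ (ρ - l') * (β * r) := by linarith
    have := nonneg_of_mul_nonneg_left h2 (mul_pos hβ0 hr0)
    linarith
  refine ⟨β, ρ, hβ0, by linarith, hρ4, fun f hf hfW x y => ?_⟩
  have hWi : ∀ x, Integrable (fun z => 1 + β * V z) (R x) := fun x =>
    (integrable_const 1).add ((hVi x).const_mul β)
  have hfi : ∀ x, Integrable f (R x) := fun x =>
    (hWi x).mono' hf.aestronglyMeasurable (ae_of_all _ hfW)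
  have hWint : ∀ x, ∫ z, (1 + β * V z) ∂(R x) ≤ 1 + β * (l * V x + K) := fun x => by
    rw [integral_add (integrable_const 1) ((hVi x).const_mul β), integral_const_mul]
    have := mul_le_mul_of_nonneg_left (hdr x) hβ0.le
    simpa using this
  have hW0 : ∀ z, 0 ≤ 1 + β * V z := fun z => (abs_nonneg _).trans (hfW z)
  by_cases hxy : r ≤ V x + V y
  · have hb : ∀ x, |∫ z, f z ∂(R x)| ≤ 1 + β * (l * V x + K) := fun x =>
      (norm_integral_le_of_norm_le (f := f) (hWi x) (ae_of_all _ hfW)).trans (hWint x)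
    have h1 := (abs_sub (∫ z, f z ∂(R x)) (∫ z, f z ∂(R y))).trans (add_le_add (hb x) (hb y))
    have h2 : 0 ≤ (l' - l) * (V x + V y - r) :=
      mul_nonneg (by rw [hl']; linarith) (by linarith)
    have h3 : 0 ≤ β * ((l' - l) * (V x + V y) - 2 * K) := mul_nonneg hβ0.le (by linarith)
    have h4 : 0 ≤ (ρ - l') * (β * (V x + V y - r)) :=
      mul_nonneg (by linarith) (mul_nonneg hβ0.le (by linarith))
    linarith
  · have hVx := hV x
    have hVy := hV y
    have hηle : ∀ x, V x ≤ r → |∫ z, f z ∂(R x) - ∫ z, f z ∂η| ≤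
        1 + β * (l * V x + K) - ε := fun x hx => by
      have hle := hη x hx
      have hfη : Integrable f η := (hfi x).mono_measure hle
      have hWη : Integrable (fun z => 1 + β * V z) η := (hWi x).mono_measure hle
      have hεη : ε ≤ ∫ z, (1 + β * V z) ∂η := by
        have h1 : ∫ _, (1 : ℝ) ∂η ≤ ∫ z, (1 + β * V z) ∂η :=
          integral_mono (integrable_const 1) hWη fun z => by
            have := mul_pos hβ0 (zero_lt_one.trans_le (hV z))
            simp only; linarith
        rw [integral_const, smul_eq_mul, mul_one] at h1
        exact (min_le_right _ _).trans h1
      -- `W ± f` are nonnegative, so `η ≤ R x` yields `|R f - η f| ≤ R W - η W`, and `η W ≥ ε`.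
      have h1 := integral_mono_measure (f := fun z => (1 + β * V z) - f z) hle
        (ae_of_all _ fun z => sub_nonneg.2 ((le_abs_self _).trans (hfW z))) ((hWi x).sub (hfi x))
      have h2 := integral_mono_measure (f := fun z => (1 + β * V z) + f z) hle
        (ae_of_all _ fun z => by have := (neg_le_abs (f z)).trans (hfW z); simp; linarith)
        ((hWi x).add (hfi x))
      rw [integral_sub hWη hfη, integral_sub (hWi x) (hfi x)] at h1
      rw [integral_add hWη hfη, integral_add (hWi x) (hfi x)] at h2
      have h3 := hWint x
      rw [abs_le]
      constructor <;> linarith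
    have h1 := hηle x (by linarith)
    have h2 := hηle y (by linarith)
    have h3 := abs_sub_le (∫ z, f z ∂(R x)) (∫ z, f z ∂η) (∫ z, f z ∂(R y))
    rw [abs_sub_comm (∫ z, f z ∂η)] at h3
    have h4 : 0 ≤ (ρ - l) * (β * (V x + V y)) :=
      mul_nonneg (by linarith) (mul_nonneg hβ0.le (by linarith))
    linarith

/-- Under drift and minorization, the iterates of `R` contract `vDist V` geometrically. -/
theorem exists_vDist_bind_pow_le [IsMarkovKernel R] (h : HarrisCondition V R l K) :
    ∃ C ρ : ℝ, 0 ≤ C ∧ 0 ≤ ρ ∧ ρ < 1 ∧ ∀ (n : ℕ) (μ ν : Measure E) [IsProbabilityMeasure μ]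
      [IsProbabilityMeasure ν], vDist V (μ.bind ⇑(R ^ n)) (ν.bind ⇑(R ^ n)) ≤
        ENNReal.ofReal (C * ρ ^ n) * vDist V μ ν := by
  obtain ⟨β, ρ, hβ, hρ0, hρ1, hosc⟩ := h.exists_oscillation_contraction
  refine ⟨β⁻¹ * (1 + β), ρ, by positivity, hρ0.le, hρ1, fun n μ ν _ _ => ?_⟩
  have : Nonempty E := nonempty_of_isProbabilityMeasure μ
  -- The induction uses the weight `1 + βV`, so changing weights costs a constant only once.
  have hW : vDist (fun x => 1 + β * V x) (μ.bind ⇑(R ^ n)) (ν.bind ⇑(R ^ n)) ≤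
      ENNReal.ofReal (ρ ^ n) * vDist (fun x => 1 + β * V x) μ ν := by
    induction n with
    | zero => rw [bind_pow_zero, bind_pow_zero, pow_zero, ENNReal.ofReal_one, one_mul]
    | succ n ih =>
      have := isProbabilityMeasure_bind_pow R μ n
      have := isProbabilityMeasure_bind_pow R ν n
      rw [bind_pow_succ, bind_pow_succ, pow_succ', ENNReal.ofReal_mul hρ0.le, mul_assoc]
      exact (vDist_bind_le_of_oscillation hρ0 hosc _ _).trans (mul_le_mul_right ih _)
  have h1 := vDist_le_const_mul (V := V) (W := fun x => 1 + β * V x) (inv_pos.2 hβ)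
    (fun x => by rw [mul_add, inv_mul_cancel_left₀ hβ.ne']; have := inv_pos.2 hβ; linarith)
    (μ.bind ⇑(R ^ n)) (ν.bind ⇑(R ^ n))
  have h2 := vDist_le_const_mul (V := fun x => 1 + β * V x) (W := V) (c := 1 + β) (by linarith)
    (fun x => by have := h.one_le x; linarith) μ ν
  calc vDist V (μ.bind ⇑(R ^ n)) (ν.bind ⇑(R ^ n))
      ≤ ENNReal.ofReal β⁻¹ * (ENNReal.ofReal (ρ ^ n) * (ENNReal.ofReal (1 + β) * vDist V μ ν)) :=
        h1.trans (mul_le_mul_right (hW.trans (mul_le_mul_right h2 _)) _)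
    _ = ENNReal.ofReal (β⁻¹ * (1 + β) * ρ ^ n) * vDist V μ ν := by
        rw [ENNReal.ofReal_mul (by positivity), ENNReal.ofReal_mul (by positivity)]
        ring

end HarrisCondition

/-- A sequence of probability measures that is Cauchy uniformly over measurable sets has a
limit. -/
theorem exists_measure_of_uniform_cauchy (μ : ℕ → Measure E) [∀ n, IsProbabilityMeasure (μ n)]
    (r : ℕ → ℝ) (hr : Tendsto r atTop (𝓝 0))
    (h : ∀ m n, m ≤ n → ∀ A, MeasurableSet A → |(μ m).real A - (μ n).real A| ≤ r m) :
    ∃ π : Measure E, IsProbabilityMeasure π ∧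
      ∀ n A, MeasurableSet A → |(μ n).real A - π.real A| ≤ r n := by
  have hlim : ∀ A, MeasurableSet A → ∃ p, Tendsto (fun n => (μ n).real A) atTop (𝓝 p) :=
    fun A hA => cauchySeq_tendsto_of_complete
      (cauchySeq_of_le_tendsto_0' r (fun m n hmn => h m n hmn A hA) hr)
  choose! p hp using hlim
  have hp0 : ∀ A, MeasurableSet A → 0 ≤ p A := fun A hA =>
    ge_of_tendsto' (hp A hA) fun n => measureReal_nonneg
  have hclose : ∀ n A, MeasurableSet A → |(μ n).real A - p A| ≤ r n := fun n A hA =>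
    le_of_tendsto ((tendsto_const_nhds.sub (hp A hA)).abs)
      (eventually_atTop.2 ⟨n, fun m hm => h n m hm A hA⟩)
  -- Countable additivity of the limit: uniformity over sets permits exchanging the limit in `n`
  -- with that of the partial sums.
  have hsum : ∀ A : ℕ → Set E, (∀ i, MeasurableSet (A i)) → Pairwise (Function.onFun Disjoint A) →
      HasSum (fun i => p (A i)) (p (⋃ i, A i)) := fun A hA hd => by
    have hfin : ∀ (s : Finset ℕ) n,
        ∑ i ∈ s, (μ n).real (A i) = (μ n).real (⋃ i ∈ s, A i) := fun s n =>
      (measureReal_biUnion_finset (fun i _ j _ hij => hd hij) fun i _ => hA i).symm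
    have hpfin : ∀ s : Finset ℕ, ∑ i ∈ s, p (A i) = p (⋃ i ∈ s, A i) := fun s => by
      refine tendsto_nhds_unique (tendsto_finsetSum s fun i _ => hp (A i) (hA i)) ?_
      simp only [hfin]
      exact hp _ (s.measurableSet_biUnion fun i _ => hA i)
    refine TendstoUniformly.tendsto_of_eventually_tendsto
      (F := fun n (s : Finset ℕ) => ∑ i ∈ s, (μ n).real (A i)) (p := atTop)
      (L := fun n => (μ n).real (⋃ i, A i)) ?_ (Eventually.of_forall fun n => ?_)
      (hp _ (MeasurableSet.iUnion hA))
    · rw [Metric.tendstoUniformly_iff]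
      intro ε hε
      filter_upwards [hr.eventually (gt_mem_nhds hε)] with n hn s
      rw [hfin, hpfin, dist_comm, Real.dist_eq]
      exact (hclose n _ (s.measurableSet_biUnion fun i _ => hA i)).trans_lt hn
    · have := ENNReal.hasSum_toReal (f := fun i => μ n (A i))
        (by rw [← measure_iUnion hd hA]; exact measure_ne_top _ _)
      rw [← ENNReal.tsum_toReal_eq (fun i => measure_ne_top _ _),
        ← measure_iUnion hd hA] at this
      exact this
  have hempty : p ∅ = 0 := tendsto_nhds_unique (hp ∅ .empty) (by simp)
  let π : Measure E := Measure.ofMeasurable (fun A _ => ENNReal.ofReal (p A)) (by simp [hempty])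
    fun A hA hd => by
      rw [← (hsum A hA hd).tsum_eq]
      exact ENNReal.ofReal_tsum_of_nonneg (fun i => hp0 _ (hA i)) (hsum A hA hd).summable
  have hπ : ∀ A, MeasurableSet A → π A = ENNReal.ofReal (p A) := fun A hA =>
    Measure.ofMeasurable_apply A hA
  refine ⟨π, ⟨?_⟩, fun n A hA => ?_⟩
  · rw [hπ _ .univ, ← ENNReal.ofReal_one]
    congr 1
    exact tendsto_nhds_unique (hp _ .univ) (by simp)
  · rw [measureReal_def π, hπ A hA, ENNReal.toReal_ofReal (hp0 A hA)]
    exact hclose n A hA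

/-- By the layer-cake formula, the integral of a `[0,1]`-valued function averages the measures of
its superlevel sets over levels in `(0,1]`, so the error on sets carries over without loss. -/
theorem lintegral_le_add_of_measureReal_close {μ ν : Measure E} [IsProbabilityMeasure μ]
    [IsProbabilityMeasure ν] {r : ℝ}
    (h : ∀ A, MeasurableSet A → |μ.real A - ν.real A| ≤ r) {f : E → ℝ≥0∞} (hf : Measurable f)
    (hf1 : ∀ x, f x ≤ 1) : ∫⁻ x, f x ∂ν ≤ ∫⁻ x, f x ∂μ + ENNReal.ofReal r := by
  have hset : ∀ A, MeasurableSet A → ν A ≤ μ A + ENNReal.ofReal r := fun A hA => by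
    have hr : 0 ≤ r := (abs_nonneg _).trans (h A hA)
    rw [← ofReal_measureReal (μ := ν), ← ofReal_measureReal (μ := μ),
      ← ENNReal.ofReal_add measureReal_nonneg hr]
    refine ENNReal.ofReal_le_ofReal ?_
    have := (abs_le.1 (h A hA)).1
    linarith
  have hft : ∀ x, f x ≠ ∞ := fun x => ((hf1 x).trans_lt ENNReal.one_lt_top).ne
  have hfm : Measurable fun x => (f x).toReal := hf.ennreal_toReal
  have hlayer : ∀ κ : Measure E, ∫⁻ x, f x ∂κ =
      ∫⁻ t in Set.Ioc (0 : ℝ) 1, κ {x | t < (f x).toReal} := fun κ => by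
    have h1 := lintegral_eq_lintegral_meas_lt κ (ae_of_all _ fun x => ENNReal.toReal_nonneg)
      hfm.aemeasurable
    simp only [ENNReal.ofReal_toReal (hft _)] at h1
    rw [h1, ← Set.Ioc_union_Ioi_eq_Ioi zero_le_one,
      lintegral_union measurableSet_Ioi (Set.Ioc_disjoint_Ioi le_rfl)]
    have h2 : ∫⁻ t in Set.Ioi (1 : ℝ), κ {x | t < (f x).toReal} = 0 := by
      rw [← lintegral_zero (μ := volume.restrict (Set.Ioi (1 : ℝ)))]
      refine setLIntegral_congr_fun measurableSet_Ioi fun t ht => ?_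
      have : {x | t < (f x).toReal} = ∅ := by
        ext x
        have h3 : (f x).toReal ≤ 1 := ENNReal.toReal_mono ENNReal.one_ne_top (hf1 x)
        simpa using h3.trans (le_of_lt ht)
      simp [this]
    rw [h2, add_zero]
  rw [hlayer, hlayer]
  calc ∫⁻ t in Set.Ioc (0 : ℝ) 1, ν {x | t < (f x).toReal}
      ≤ ∫⁻ t in Set.Ioc (0 : ℝ) 1, (μ {x | t < (f x).toReal} + ENNReal.ofReal r) :=
        lintegral_mono fun t => hset _ (measurableSet_lt measurable_const hfm)
    _ = _ := by
        rw [lintegral_add_right _ measurable_const]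
        simp

/-! ### Invariant measures: integrability, existence, uniqueness -/

namespace HarrisCondition

variable {V : E → ℝ} {R : Kernel E E} {l K : ℝ}

theorem invariant_bind_pow {π : Measure E} (hπ : R.Invariant π) (n : ℕ) :
    π.bind ⇑(R ^ n) = π := by
  induction n with
  | zero => exact bind_pow_zero R π
  | succ n ih => rw [bind_pow_succ, ih]; exact hπ.def

/-- Every invariant probability measure integrates the Lyapunov function. -/
theorem integrable_of_invariant [IsMarkovKernel R] (h : HarrisCondition V R l K)
    {π : Measure E} [IsProbabilityMeasure π] (hπ : R.Invariant π) : Integrable V π := by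
  have hV0 : ∀ x, 0 ≤ V x := fun x => zero_le_one.trans (h.one_le x)
  set c := K / (1 - l) with hc
  have hc0 : 0 ≤ c := div_nonneg h.const_nonneg (sub_pos.2 h.rate_lt_one).le
  have hpow : ∀ x n, ∫⁻ y, ENNReal.ofReal (V y) ∂((R ^ n) x) ≤ ENNReal.ofReal (l ^ n * V x + c) :=
    fun x n => by
      have hd : (Measure.dirac x).bind ⇑(R ^ n) = (R ^ n) x :=
        Measure.dirac_bind (Kernel.measurable _) x
      have hi : Integrable V (Measure.dirac x) :=
        (integrable_dirac' h.measurable.stronglyMeasurable (by simp))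
      obtain ⟨h1, h2⟩ := h.integrable_bind_pow hi n
      rw [hd, integral_dirac' _ _ h.measurable.stronglyMeasurable] at h2
      rw [hd] at h1
      rw [← ofReal_integral_eq_lintegral_ofReal h1 (ae_of_all _ hV0)]
      exact ENNReal.ofReal_le_ofReal h2
  -- Integrability of `V` is not yet known, so invariance under `R ^ n` is used on `min V N`;
  -- dominated convergence in `n` then removes the term `l ^ n * V`.
  have htrunc : ∀ N : ℕ, ∫⁻ x, min (ENNReal.ofReal (V x)) N ∂π ≤ ENNReal.ofReal c := fun N => by
    have hm : Measurable fun x => min (ENNReal.ofReal (V x)) (N : ℝ≥0∞) :=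
      h.measurable.ennreal_ofReal.min measurable_const
    have hle : ∀ n : ℕ, ∫⁻ x, min (ENNReal.ofReal (V x)) N ∂π ≤
        ∫⁻ x, min (ENNReal.ofReal (l ^ n * V x + c)) N ∂π := fun n => by
      have hM : IsMarkovKernel (R ^ n) := ⟨fun x => by
        have := isProbabilityMeasure_bind_pow R (Measure.dirac x) n
        rwa [Measure.dirac_bind (Kernel.measurable _) x] at this⟩
      conv_lhs => rw [← invariant_bind_pow hπ n]
      rw [Measure.lintegral_bind (Kernel.aemeasurable _) hm.aemeasurable]
      refine lintegral_mono fun x => le_min ?_ ?_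
      · exact (lintegral_mono fun y => min_le_left _ _).trans (hpow x n)
      · refine (lintegral_mono fun y => min_le_right _ _).trans ?_
        simp
    have hlim : Tendsto (fun n : ℕ => ∫⁻ x, min (ENNReal.ofReal (l ^ n * V x + c)) N ∂π) atTop
        (𝓝 (∫⁻ _, min (ENNReal.ofReal c) N ∂π)) := by
      refine tendsto_lintegral_of_dominated_convergence (fun _ => (N : ℝ≥0∞))
        (fun n => ((h.measurable.const_mul _).add_const _).ennreal_ofReal.min measurable_const)
        (fun n => ae_of_all _ fun x => min_le_right _ _) (by simp) (ae_of_all _ fun x => ?_)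
      refine Tendsto.min ?_ tendsto_const_nhds
      refine (ENNReal.continuous_ofReal.tendsto c).comp ?_
      have := ((tendsto_pow_atTop_nhds_zero_of_lt_one h.rate_nonneg h.rate_lt_one).mul_const
        (V x)).add_const c
      simpa using this
    refine (ge_of_tendsto' hlim hle).trans ?_
    simp
  have hmono : ∫⁻ x, ENNReal.ofReal (V x) ∂π ≤ ENNReal.ofReal c := by
    have hsup : ∀ x, ENNReal.ofReal (V x) = ⨆ N : ℕ, min (ENNReal.ofReal (V x)) (N : ℝ≥0∞) :=
      fun x => by
        refine le_antisymm ?_ (iSup_le fun N => min_le_left _ _)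
        obtain ⟨N, hN⟩ := exists_nat_ge (V x)
        refine le_iSup_of_le N (le_min le_rfl ?_)
        rw [← ENNReal.ofReal_natCast]
        exact ENNReal.ofReal_le_ofReal hN
    rw [lintegral_congr hsup, lintegral_iSup
      (fun N => h.measurable.ennreal_ofReal.min measurable_const)
      (fun i j hij x => min_le_min le_rfl (by exact_mod_cast hij))]
    exact iSup_le htrunc
  refine ⟨h.measurable.aestronglyMeasurable, ?_⟩
  rw [hasFiniteIntegral_iff_ofReal (ae_of_all _ hV0)]
  exact hmono.trans_lt ENNReal.ofReal_lt_top

theorem exists_invariant [Nonempty E] [IsMarkovKernel R] (h : HarrisCondition V R l K) :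
    ∃ π : Measure E, IsProbabilityMeasure π ∧ R.Invariant π := by
  obtain ⟨C, ρ, hC, hρ0, hρ1, hcon⟩ := h.exists_vDist_bind_pow_le
  obtain ⟨x₀⟩ := ‹Nonempty E›
  set μ : ℕ → Measure E := fun n => (Measure.dirac x₀).bind ⇑(R ^ n) with hμ
  have hμP : ∀ n, IsProbabilityMeasure (μ n) := fun n => isProbabilityMeasure_bind_pow R _ n
  have hVi : Integrable V (Measure.dirac x₀) :=
    integrable_dirac' h.measurable.stronglyMeasurable (by simp)
  have hV0 := h.one_le x₀
  -- Bounds the `V`-distance from `δ_{x₀}` to every iterate; applying `R ^ m` to both shrinks it to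
  -- `r m`.
  set B := V x₀ + (V x₀ + K / (1 - l)) with hB
  have hc0 : 0 ≤ K / (1 - l) := div_nonneg h.const_nonneg (sub_pos.2 h.rate_lt_one).le
  have hB0 : 0 ≤ B := by rw [hB]; linarith
  set r : ℕ → ℝ := fun n => C * ρ ^ n * B with hr
  have hr0 : ∀ n, 0 ≤ r n := fun n => by rw [hr]; positivity
  have hrlim : Tendsto r atTop (𝓝 0) := by
    have := ((tendsto_pow_atTop_nhds_zero_of_lt_one hρ0 hρ1).const_mul C).mul_const B
    simpa using this
  obtain ⟨π, hπP, hπ⟩ := exists_measure_of_uniform_cauchy μ r hrlim fun m n hmn A hA => by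
    obtain ⟨k, rfl⟩ := Nat.exists_eq_add_of_le hmn
    have h1 := ofReal_abs_measureReal_sub_le_vDist h.one_le (μ m) (μ (m + k)) hA
    have h2 : μ (m + k) = (μ k).bind ⇑(R ^ m) := bind_pow_add R _ k m
    obtain ⟨h3, h4⟩ := h.integrable_bind_pow hVi k
    rw [integral_dirac' _ _ h.measurable.stronglyMeasurable] at h4
    have h5 : ∫ x, V x ∂(Measure.dirac x₀) + ∫ x, V x ∂(μ k) ≤ B := by
      rw [integral_dirac' _ _ h.measurable.stronglyMeasurable]
      have := mul_le_of_le_one_left (zero_le_one.trans hV0)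
        (pow_le_one₀ (n := k) h.rate_nonneg h.rate_lt_one.le)
      rw [hB]
      linarith
    have h6 := (hcon m (Measure.dirac x₀) (μ k)).trans (mul_le_mul_right
      ((vDist_le_integral_add hVi h3).trans (ENNReal.ofReal_le_ofReal h5)) _)
    rw [← ENNReal.ofReal_mul (by positivity)] at h6
    rw [h2] at h1 ⊢
    exact (ENNReal.ofReal_le_ofReal_iff (hr0 m)).1 (h1.trans h6)
  refine ⟨π, hπP, ?_⟩
  -- One inequality is enough, as both sides have mass one.
  have hle : π.bind ⇑R ≤ π := Measure.le_iff.2 fun A hA => by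
    have hfm : Measurable fun x => R x A := Kernel.measurable_coe R hA
    have hstep : ∀ n, (π.bind ⇑R) A ≤
        π A + (ENNReal.ofReal (r (n + 1)) + ENNReal.ofReal (r n)) := fun n => by
      have h1 := lintegral_le_add_of_measureReal_close (hπ n) hfm fun x => prob_le_one
      rw [← Measure.bind_apply hA (Kernel.aemeasurable _),
        ← Measure.bind_apply hA (Kernel.aemeasurable _)] at h1
      have h2 : (μ n).bind ⇑R = μ (n + 1) := (bind_pow_succ R _ n).symm
      have h3 := lintegral_le_add_of_measureReal_close (μ := π) (ν := μ (n + 1)) (r := r (n + 1))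
        (fun A hA => by rw [abs_sub_comm]; exact hπ (n + 1) A hA)
        (measurable_const.indicator hA : Measurable (A.indicator fun _ => (1 : ℝ≥0∞)))
        (fun x => by by_cases hx : x ∈ A <;> simp [hx])
      rw [lintegral_indicator_const hA, lintegral_indicator_const hA, one_mul, one_mul] at h3
      rw [h2] at h1
      rw [← add_assoc]
      exact h1.trans (add_le_add_left h3 _)
    have hz : Tendsto (fun n => ENNReal.ofReal (r n)) atTop (𝓝 0) := by
      simpa [Function.comp_def] using (ENNReal.continuous_ofReal.tendsto 0).comp hrlim
    have hlim := (((tendsto_add_atTop_iff_nat 1).2 hz).add hz).const_add (π A)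
    rw [add_zero, add_zero] at hlim
    exact ge_of_tendsto' hlim hstep
  exact Measure.eq_of_le_of_isProbabilityMeasure hle

/-- The iterates do not move either measure, so their distance is at most `C ρ ^ n` times itself;
integrability of `V` makes it finite, hence zero. -/
theorem eq_of_invariant [IsMarkovKernel R] (h : HarrisCondition V R l K)
    {π ν : Measure E} [IsProbabilityMeasure π] [IsProbabilityMeasure ν] (hπ : R.Invariant π)
    (hν : R.Invariant ν) : ν = π := by
  obtain ⟨C, ρ, -, hρ0, hρ1, hcon⟩ := h.exists_vDist_bind_pow_le
  have hfin : vDist V ν π ≠ ∞ := ((vDist_le_integral_add (h.integrable_of_invariant hν)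
    (h.integrable_of_invariant hπ)).trans_lt ENNReal.ofReal_lt_top).ne
  have hzero : vDist V ν π ≤ 0 := by
    have hlim : Tendsto (fun n => ENNReal.ofReal (C * ρ ^ n) * vDist V ν π) atTop
        (𝓝 (0 * vDist V ν π)) := by
      refine ENNReal.Tendsto.mul_const ?_ (Or.inr hfin)
      have h1 := (tendsto_pow_atTop_nhds_zero_of_lt_one hρ0 hρ1).const_mul C
      rw [mul_zero] at h1
      simpa [Function.comp_def] using (ENNReal.continuous_ofReal.tendsto 0).comp h1
    rw [zero_mul] at hlim
    refine ge_of_tendsto' hlim fun n => ?_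
    have := hcon n ν π
    rwa [invariant_bind_pow hπ, invariant_bind_pow hν] at this
  refine Measure.ext fun A hA => ?_
  have h1 := (ofReal_abs_measureReal_sub_le_vDist h.one_le ν π hA).trans hzero
  rw [nonpos_iff_eq_zero, ENNReal.ofReal_eq_zero, abs_nonpos_iff, sub_eq_zero] at h1
  exact (measureReal_eq_measureReal_iff).1 h1

/-- **Harris' theorem** in weighted total variation distance. -/
theorem exists_unique_vGeometricallyErgodic [Nonempty E] [IsMarkovKernel R]
    (h : HarrisCondition V R l K) :
    ∃ π : Measure E, IsProbabilityMeasure π ∧ R.Invariant π ∧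
      (∀ ν : Measure E, IsProbabilityMeasure ν → R.Invariant ν → ν = π) ∧
      VGeometricallyErgodic V R π := by
  obtain ⟨π, hπP, hπ⟩ := h.exists_invariant
  refine ⟨π, hπP, hπ, fun ν _ hν => h.eq_of_invariant hπ hν, hπ, h.integrable_of_invariant hπ, ?_⟩
  have hπV := h.integrable_of_invariant hπ
  obtain ⟨C, ρ, hC, hρ0, hρ1, hcon⟩ := h.exists_vDist_bind_pow_le
  have hge : ∀ μ : Measure E, IsProbabilityMeasure μ → Integrable V μ → 1 ≤ ∫ x, V x ∂μ :=
    fun μ _ hμ => by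
      have := integral_mono (integrable_const 1) hμ h.one_le
      simpa using this
  have hB := hge π hπP hπV
  set B := ∫ x, V x ∂π
  -- The factor `1 + B` turns `μ(V) + π(V)` into a multiple of `μ(V)`, using `μ(V) ≥ 1`.
  refine ⟨C * (1 + B), ρ, by positivity, hρ0, hρ1, fun n μ hμ hμV => ⟨fun ν hν hνV => ?_, ?_⟩⟩
  · refine (hcon n μ ν).trans (mul_le_mul_left (ENNReal.ofReal_le_ofReal ?_) _)
    refine mul_le_mul_of_nonneg_right ?_ (pow_nonneg hρ0 n)
    exact le_mul_of_one_le_right hC (by linarith)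
  · have h1 := (hcon n μ π).trans (mul_le_mul_right (vDist_le_integral_add hμV hπV) _)
    rw [invariant_bind_pow hπ, ← ENNReal.ofReal_mul (by positivity)] at h1
    refine h1.trans (ENNReal.ofReal_le_ofReal ?_)
    have h2 : ∫ x, V x ∂μ + B ≤ (1 + B) * ∫ x, V x ∂μ := by
      have := mul_le_mul_of_nonneg_left (hge μ hμ hμV) (zero_le_one.trans hB)
      linarith
    calc C * ρ ^ n * (∫ x, V x ∂μ + B) ≤ C * ρ ^ n * ((1 + B) * ∫ x, V x ∂μ) :=
          mul_le_mul_of_nonneg_left h2 (by positivity)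
      _ = C * (1 + B) * ρ ^ n * ∫ x, V x ∂μ := by ring

end HarrisCondition

end Harris

/-! ### Gaussian exponential moments and minorization -/

section Gaussian

variable {d : ℕ}

theorem integrable_exp_inner_add_sq_norm (v : EuclideanSpace ℝ (Fin d)) {b : ℝ} (hb : 0 < b) :
    Integrable (fun z : EuclideanSpace ℝ (Fin d) => Real.exp (-b * ‖z‖ ^ 2 + inner ℝ v z)) ∧
      ∫ z : EuclideanSpace ℝ (Fin d), Real.exp (-b * ‖z‖ ^ 2 + inner ℝ v z) =
        (Real.pi / b) ^ ((d : ℝ) / 2) * Real.exp (‖v‖ ^ 2 / (4 * b)) := by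
  have hre : 0 < (b : ℂ).re := hb
  have hfun : ∀ z : EuclideanSpace ℝ (Fin d),
      Complex.exp (-(b : ℂ) * ‖z‖ ^ 2 + 1 * (inner ℝ v z : ℝ)) =
        ((Real.exp (-b * ‖z‖ ^ 2 + inner ℝ v z) : ℝ) : ℂ) := fun z => by
    push_cast; simp
  have h1 := GaussianFourier.integrable_cexp_neg_mul_sq_norm_add hre 1 v
  have h2 := GaussianFourier.integral_cexp_neg_mul_sq_norm_add hre 1 v
  simp only [hfun] at h1 h2
  refine ⟨by simpa only [RCLike.re_eq_complex_re, Complex.ofReal_re] using h1.re, ?_⟩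
  rw [integral_complex_ofReal] at h2
  rw [← Complex.ofReal_inj]
  refine h2.trans ?_
  have hpi : 0 ≤ Real.pi / b := by positivity
  push_cast [Complex.ofReal_cpow hpi]
  simp

theorem gaussian_eq_withDensity_toNNReal : gaussian d = volume.withDensity fun z =>
    ((Real.toNNReal ((2 * Real.pi) ^ (-(d : ℝ) / 2) * Real.exp (-‖z‖ ^ 2 / 2)) : NNReal) : ℝ≥0∞) :=
  rfl

/-- Exponential moments of quadratic functions under the standard Gaussian. -/
theorem gaussian_exp_inner_add_sq_norm (v : EuclideanSpace ℝ (Fin d)) {c : ℝ} (hc : 2 * c < 1) :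
    Integrable (fun z => Real.exp (inner ℝ v z + c * ‖z‖ ^ 2)) (gaussian d) ∧
      ∫ z, Real.exp (inner ℝ v z + c * ‖z‖ ^ 2) ∂(gaussian d) =
        (1 - 2 * c) ^ (-(d : ℝ) / 2) * Real.exp (‖v‖ ^ 2 / (2 * (1 - 2 * c))) := by
  have hb : 0 < (1 - 2 * c) / 2 := by linarith
  obtain ⟨h1, h2⟩ := integrable_exp_inner_add_sq_norm v hb
  set Z : ℝ := (2 * Real.pi) ^ (-(d : ℝ) / 2) with hZ
  have hZ0 : 0 ≤ Z := by positivity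
  have hfun : ∀ z : EuclideanSpace ℝ (Fin d),
      (Real.toNNReal (Z * Real.exp (-‖z‖ ^ 2 / 2))) • Real.exp (inner ℝ v z + c * ‖z‖ ^ 2) =
        Z * Real.exp (-((1 - 2 * c) / 2) * ‖z‖ ^ 2 + inner ℝ v z) := fun z => by
    rw [NNReal.smul_def, Real.coe_toNNReal _ (by positivity), smul_eq_mul, mul_assoc, ← Real.exp_add]
    congr 2
    ring
  have hm : Measurable fun z : EuclideanSpace ℝ (Fin d) =>
      Real.toNNReal (Z * Real.exp (-‖z‖ ^ 2 / 2)) := by fun_prop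
  rw [gaussian_eq_withDensity_toNNReal]
  constructor
  · rw [integrable_withDensity_iff_integrable_smul hm]
    simp only [hfun]
    exact h1.const_mul Z
  · rw [integral_withDensity_eq_integral_smul hm]
    simp only [hfun]
    rw [integral_const_mul, h2, ← mul_assoc]
    have h3 : Real.pi / ((1 - 2 * c) / 2) = (2 * Real.pi) * (1 - 2 * c)⁻¹ := by
      have : 1 - 2 * c ≠ 0 := by linarith
      field_simp
    rw [h3, Real.mul_rpow (by positivity) (by rw [inv_nonneg]; linarith), ← mul_assoc, hZ,
      ← Real.rpow_add (by positivity), Real.inv_rpow (by linarith), ← Real.rpow_neg (by linarith)]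
    congr 2
    · rw [neg_div, neg_add_cancel, Real.rpow_zero, one_mul]
    · ring

instance isProbabilityMeasure_gaussian : IsProbabilityMeasure (gaussian d) := by
  have h := (gaussian_exp_inner_add_sq_norm (0 : EuclideanSpace ℝ (Fin d))
    (c := 0) (by norm_num)).2
  simp only [inner_zero_left, zero_mul, add_zero, Real.exp_zero, mul_zero, sub_zero,
    Real.one_rpow, norm_zero, one_mul] at h
  rw [integral_const, smul_eq_mul, mul_one] at h
  simp only [ne_eq, OfNat.ofNat_ne_zero, not_false_eq_true, zero_pow, zero_div,
    Real.exp_zero] at h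
  refine ⟨?_⟩
  rw [measureReal_def] at h
  exact (ENNReal.toReal_eq_one_iff _).1 h

/-- The laws of `y + σ Z`, for `y` in a bounded set, have a common nonzero lower bound. -/
theorem exists_le_map_gaussian {σ : ℝ} (hσ : 0 < σ) (r : ℝ) :
    ∃ η : Measure (EuclideanSpace ℝ (Fin d)), IsFiniteMeasure η ∧ η ≠ 0 ∧
      ∀ y : EuclideanSpace ℝ (Fin d), ‖y‖ ≤ r → η ≤ (gaussian d).map fun z => y + σ • z := by
  set B := Metric.ball (0 : EuclideanSpace ℝ (Fin d)) 1 with hB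
  -- If `y + σz` lies in the unit ball and `‖y‖ ≤ r`, then `‖z‖ ≤ ρ`; so `p` bounds the density from
  -- below there, and `s` is the Jacobian of the scaling.
  set ρ := (1 + r) / σ with hρ
  set p : ℝ := (2 * Real.pi) ^ (-(d : ℝ) / 2) * Real.exp (-ρ ^ 2 / 2) with hp
  have hp0 : 0 < p := by positivity
  set s : ℝ := |(σ ^ Module.finrank ℝ (EuclideanSpace ℝ (Fin d)))⁻¹| with hs
  have hs0 : 0 < s := by positivity
  refine ⟨(ENNReal.ofReal p * ENNReal.ofReal s) • volume.restrict B, ⟨?_⟩, fun h0 => ?_,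
    fun y hy => Measure.le_iff.2 fun A hA => ?_⟩
  · rw [Measure.smul_apply, Measure.restrict_apply_univ, smul_eq_mul]
    exact ENNReal.mul_lt_top (ENNReal.mul_lt_top ENNReal.ofReal_lt_top ENNReal.ofReal_lt_top)
      measure_ball_lt_top
  · have h1 : ((ENNReal.ofReal p * ENNReal.ofReal s) • volume.restrict B) Set.univ = 0 := by
      rw [h0]; simp
    rw [Measure.smul_apply, Measure.restrict_apply_univ, smul_eq_mul] at h1
    have h2 := Metric.measure_ball_pos volume (0 : EuclideanSpace ℝ (Fin d)) one_pos
    simp [hp0.not_ge, hs0.not_ge, h2.ne', hB] at h1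
  · have hf : Measurable fun z : EuclideanSpace ℝ (Fin d) => y + σ • z := by fun_prop
    have hAB : MeasurableSet (A ∩ B) := hA.inter measurableSet_ball
    have hvol : volume ((fun z : EuclideanSpace ℝ (Fin d) => y + σ • z) ⁻¹' (A ∩ B)) =
        ENNReal.ofReal s * volume (A ∩ B) := by
      have : (fun z : EuclideanSpace ℝ (Fin d) => y + σ • z) ⁻¹' (A ∩ B) =
        (σ • ·) ⁻¹' ((y + ·) ⁻¹' (A ∩ B)) := rfl
      rw [this, Measure.addHaar_preimage_smul volume hσ.ne', measure_preimage_add]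
    rw [Measure.smul_apply, Measure.restrict_apply hA, smul_eq_mul, Measure.map_apply hf hA,
      mul_assoc, ← hvol]
    refine le_trans ?_ (measure_mono (Set.preimage_mono (Set.inter_subset_left (t := B))))
    rw [gaussian, withDensity_apply _ (hf hAB), ← setLIntegral_const]
    refine setLIntegral_mono' (hf hAB) fun z hz => ENNReal.ofReal_le_ofReal ?_
    have hzB : ‖y + σ • z‖ < 1 := by simpa [hB] using hz.2
    have hzn : ‖z‖ ≤ ρ := by
      rw [hρ, le_div_iff₀ hσ]
      have h1 : ‖σ • z‖ ≤ ‖y + σ • z‖ + ‖y‖ := by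
        have := norm_sub_le (y + σ • z) y
        rwa [add_sub_cancel_left] at this
      rw [norm_smul, Real.norm_of_nonneg hσ.le] at h1
      linarith
    have hsq : ‖z‖ ^ 2 ≤ ρ ^ 2 := pow_le_pow_left₀ (norm_nonneg z) hzn 2
    refine mul_le_mul_of_nonneg_left (Real.exp_le_exp.2 ?_) (by positivity)
    linarith

end Gaussian

/-! ### Drift and minorization for the Euler kernel -/

section Euler

variable {d : ℕ} {γ : ℝ} {H : EuclideanSpace ℝ (Fin d) → EuclideanSpace ℝ (Fin d)}

theorem eulerKernel_apply (hH : Measurable H) (x : EuclideanSpace ℝ (Fin d)) :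
    eulerKernel γ H hH x = (gaussian d).map fun z => x - γ • H x + Real.sqrt (2 * γ) • z :=
  rfl

instance isMarkovKernel_eulerKernel (hH : Measurable H) : IsMarkovKernel (eulerKernel γ H hH) :=
  ⟨fun x => by
    rw [eulerKernel_apply]
    exact Measure.isProbabilityMeasure_map (by fun_prop)⟩

theorem continuous_lyapunov (a : ℝ) : Continuous (lyapunov (d := d) a) := by
  unfold lyapunov
  fun_prop

theorem one_le_lyapunov {a : ℝ} (ha : 0 ≤ a) (x : EuclideanSpace ℝ (Fin d)) : 1 ≤ lyapunov a x :=
  Real.one_le_exp (mul_nonneg ha (Real.sqrt_nonneg _))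

/-- The Gaussian moment bound obtained from `√s ≤ (s + m²) / (2m)`. -/
theorem integral_lyapunov_eulerKernel_le (hH : Measurable H) (hγ : 0 < γ) {a m : ℝ} (ha : 0 < a)
    (hm : 0 < m) (hc : 2 * (a * γ / m) < 1) (x : EuclideanSpace ℝ (Fin d)) :
    Integrable (lyapunov a) (eulerKernel γ H hH x) ∧
      ∫ y, lyapunov a y ∂(eulerKernel γ H hH x) ≤
        Real.exp (a * ((1 + ‖x - γ • H x‖ ^ 2 + m ^ 2) / (2 * m))) *
          ((1 - 2 * (a * γ / m)) ^ (-(d : ℝ) / 2) *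
            Real.exp (a ^ 2 * γ * ‖x - γ • H x‖ ^ 2 / m ^ 2 / (1 - 2 * (a * γ / m)))) := by
  set y := x - γ • H x with hy
  set σ := Real.sqrt (2 * γ) with hσ
  have hσ2 : σ ^ 2 = 2 * γ := Real.sq_sqrt (by positivity)
  set c := a * γ / m with hcdef
  obtain ⟨h1, h2⟩ := gaussian_exp_inner_add_sq_norm ((a * σ / m) • y) hc
  have hf : Measurable fun z : EuclideanSpace ℝ (Fin d) => y + σ • z := by fun_prop
  have hle : ∀ z, lyapunov a (y + σ • z) ≤ Real.exp (a * ((1 + ‖y‖ ^ 2 + m ^ 2) / (2 * m))) *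
      Real.exp (inner ℝ ((a * σ / m) • y) z + c * ‖z‖ ^ 2) := fun z => by
    rw [← Real.exp_add, lyapunov]
    refine Real.exp_le_exp.2 ?_
    set s := Real.sqrt (1 + ‖y + σ • z‖ ^ 2) with hs
    have hs2 : s ^ 2 = 1 + ‖y + σ • z‖ ^ 2 := Real.sq_sqrt (by positivity)
    have hs3 : s ≤ (s ^ 2 + m ^ 2) / (2 * m) := by
      rw [le_div_iff₀ (by positivity)]
      have := sq_nonneg (s - m)
      linarith
    have hn : ‖y + σ • z‖ ^ 2 = ‖y‖ ^ 2 + 2 * (σ * inner ℝ y z) + 2 * γ * ‖z‖ ^ 2 := by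
      rw [norm_add_sq_real, inner_smul_right, norm_smul, mul_pow, Real.norm_eq_abs, sq_abs, hσ2]
    refine (mul_le_mul_of_nonneg_left hs3 ha.le).trans (le_of_eq ?_)
    rw [hs2, hn, real_inner_smul_left, hcdef]
    field_simp
    ring
  have hdom := h1.const_mul (Real.exp (a * ((1 + ‖y‖ ^ 2 + m ^ 2) / (2 * m))))
  have hint : Integrable (fun z => lyapunov a (y + σ • z)) (gaussian d) :=
    hdom.mono' ((continuous_lyapunov a).measurable.comp hf).aestronglyMeasurable
      (ae_of_all _ fun z => by
        rw [Real.norm_of_nonneg (zero_le_one.trans (one_le_lyapunov ha.le _))]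
        exact hle z)
  rw [eulerKernel_apply, integrable_map_measure
    (continuous_lyapunov a).measurable.aestronglyMeasurable hf.aemeasurable,
    integral_map hf.aemeasurable (continuous_lyapunov a).measurable.aestronglyMeasurable]
  refine ⟨hint, (integral_mono hint hdom hle).trans (le_of_eq ?_)⟩
  rw [integral_const_mul, h2, norm_smul, mul_pow, Real.norm_eq_abs, sq_abs, div_pow, mul_pow, hσ2]
  congr 3
  have : 1 - 2 * c ≠ 0 := by linarith
  field_simp

/-- Expanding the square, the decrease is exactly `2γ‖x‖` times the bracket in (A2). -/
theorem exists_norm_sq_step_le {T : ℝ → EuclideanSpace ℝ (Fin d) → EuclideanSpace ℝ (Fin d)}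
    (hT : DriftErgodic T) (hγ : 0 < γ) : ∃ δ M : ℝ, 0 < δ ∧ ∀ x, M ≤ ‖x‖ →
      ‖x - γ • T γ x‖ ^ 2 ≤ ‖x‖ ^ 2 - 2 * γ * δ * ‖x‖ := by
  obtain ⟨δ, hδ0, hδ⟩ := EReal.lt_iff_exists_real_btwn.1 (hT γ hγ)
  have hev := eventually_lt_of_lt_liminf hδ
  rw [eventually_comap, eventually_atTop] at hev
  obtain ⟨M, hM⟩ := hev
  refine ⟨δ, max M 1, by exact_mod_cast hδ0, fun x hx => ?_⟩
  have hx0 : 0 < ‖x‖ := zero_lt_one.trans_le ((le_max_right _ _).trans hx)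
  have h := EReal.coe_lt_coe_iff.1 (hM ‖x‖ ((le_max_left _ _).trans hx) x rfl)
  rw [real_inner_smul_left] at h
  have h1 : δ * ‖x‖ < inner ℝ x (T γ x) - γ / 2 * ‖T γ x‖ ^ 2 := by
    have := mul_lt_mul_of_pos_right h hx0
    refine this.trans_eq ?_
    field_simp
  rw [norm_sub_sq_real, inner_smul_right, norm_smul, mul_pow, Real.norm_eq_abs, sq_abs]
  have h2 := mul_lt_mul_of_pos_left h1 hγ
  linarith

theorem exists_lyapunov_drift {T : ℝ → EuclideanSpace ℝ (Fin d) → EuclideanSpace ℝ (Fin d)}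
    (hT : DriftErgodic T) (hγ : 0 < γ) (hc : Continuous (T γ)) :
    ∃ M a b : ℝ, 0 < M ∧ 0 < a ∧ 0 < b ∧ ∀ x : EuclideanSpace ℝ (Fin d),
      Integrable (lyapunov a) (eulerKernel γ (T γ) hc.measurable x) ∧
        ∫ y, lyapunov a y ∂(eulerKernel γ (T γ) hc.measurable x) ≤
          Real.exp (-a ^ 2 * γ) * lyapunov a x +
            γ * b * (Metric.closedBall (0 : EuclideanSpace ℝ (Fin d)) M).indicator
              (fun _ => (1 : ℝ)) x := by
  obtain ⟨δ, M₀, hδ, hM₀⟩ := exists_norm_sq_step_le hT hγ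
  -- The drift contributes `-aγδ = -4a²γ` to the limiting exponent and the Gaussian fluctuation
  -- `+a²γ`, leaving a margin below `-a²γ`.
  set a := δ / 4 with ha
  have ha0 : 0 < a := by positivity
  have hδa : δ = 4 * a := by rw [ha]; ring
  have hsqrt : Tendsto (fun t : ℝ => Real.sqrt (1 + t ^ 2)) atTop atTop :=
    Real.tendsto_sqrt_atTop.comp
      (tendsto_atTop_add_const_left _ _ (tendsto_pow_atTop two_ne_zero))
  have hinv : Tendsto (fun t : ℝ => a * γ / Real.sqrt (1 + t ^ 2)) atTop (𝓝 0) :=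
    hsqrt.const_div_atTop _
  have hratio : Tendsto (fun t : ℝ => t / Real.sqrt (1 + t ^ 2)) atTop (𝓝 1) := by
    have h1 : Tendsto (fun t : ℝ => Real.sqrt (1 - (Real.sqrt (1 + t ^ 2))⁻¹ ^ 2)) atTop
        (𝓝 (Real.sqrt (1 - 0 ^ 2))) :=
      (Real.continuous_sqrt.tendsto _).comp
        (((tendsto_inv_atTop_zero.comp hsqrt).pow 2).const_sub 1)
    rw [zero_pow two_ne_zero, sub_zero, Real.sqrt_one] at h1
    refine h1.congr' ((eventually_ge_atTop 0).mono fun t ht => ?_)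
    have hp : 0 < 1 + t ^ 2 := by positivity
    rw [inv_pow, Real.sq_sqrt hp.le]
    have : 1 - (1 + t ^ 2)⁻¹ = t ^ 2 / (1 + t ^ 2) := by field_simp; ring
    rw [this, Real.sqrt_div (sq_nonneg t), Real.sqrt_sq ht]
  have hone : Tendsto (fun t : ℝ => 1 - 2 * (a * γ / Real.sqrt (1 + t ^ 2))) atTop (𝓝 1) := by
    simpa using (hinv.const_mul 2).const_sub 1
  have hlim : Tendsto (fun t : ℝ => Real.exp (-(4 * a ^ 2 * γ) * (t / Real.sqrt (1 + t ^ 2))) *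
      ((1 - 2 * (a * γ / Real.sqrt (1 + t ^ 2))) ^ (-(d : ℝ) / 2) *
        Real.exp (a ^ 2 * γ / (1 - 2 * (a * γ / Real.sqrt (1 + t ^ 2)))))) atTop
      (𝓝 (Real.exp (-(4 * a ^ 2 * γ) * 1) * (1 ^ (-(d : ℝ) / 2) *
        Real.exp (a ^ 2 * γ / 1)))) := by
    refine ((Real.continuous_exp.tendsto _).comp (hratio.const_mul _)).mul (Tendsto.mul ?_ ?_)
    · exact hone.rpow_const (Or.inl one_ne_zero)
    · exact (Real.continuous_exp.tendsto _).comp (tendsto_const_nhds.div hone one_ne_zero)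
  have hlt : Real.exp (-(4 * a ^ 2 * γ) * 1) * (1 ^ (-(d : ℝ) / 2) *
      Real.exp (a ^ 2 * γ / 1)) < Real.exp (-a ^ 2 * γ) := by
    rw [Real.one_rpow, one_mul, ← Real.exp_add, Real.exp_lt_exp]
    have : 0 < a ^ 2 * γ := by positivity
    linarith
  obtain ⟨M₁, hM₁⟩ := eventually_atTop.1
    ((hlim.eventually (gt_mem_nhds hlt)).and (hone.eventually (lt_mem_nhds one_pos)))
  set M := max (max M₀ M₁) 1 with hM
  -- On the ball any fixed `m` with `2aγ/m < 1` gives a continuous, hence bounded, majorant.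
  set m := 4 * a * γ + 1 with hm
  have hm0 : 0 < m := by positivity
  have hcm : 2 * (a * γ / m) < 1 := by
    rw [mul_div_assoc', div_lt_one hm0, hm]
    have : 0 < a * γ := by positivity
    linarith
  have hbound := fun x => integral_lyapunov_eulerKernel_le hc.measurable hγ ha0 hm0 hcm x
  have hcont : Continuous fun x : EuclideanSpace ℝ (Fin d) =>
      Real.exp (a * ((1 + ‖x - γ • T γ x‖ ^ 2 + m ^ 2) / (2 * m))) *
        ((1 - 2 * (a * γ / m)) ^ (-(d : ℝ) / 2) *
          Real.exp (a ^ 2 * γ * ‖x - γ • T γ x‖ ^ 2 / m ^ 2 / (1 - 2 * (a * γ / m)))) := by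
    fun_prop
  obtain ⟨B, hB⟩ :=
    (isCompact_closedBall (0 : EuclideanSpace ℝ (Fin d)) M).exists_bound_of_continuousOn
    hcont.continuousOn
  refine ⟨M, a, (|B| + 1) / γ, by rw [hM]; positivity, ha0, by positivity,
    fun x => ⟨(hbound x).1, ?_⟩⟩
  rw [mul_div_cancel₀ _ hγ.ne']
  by_cases hx : x ∈ Metric.closedBall (0 : EuclideanSpace ℝ (Fin d)) M
  · rw [Set.indicator_of_mem hx, mul_one]
    have h1 := (hbound x).2.trans ((le_abs_self _).trans (hB x hx))
    have h2 : 0 < Real.exp (-a ^ 2 * γ) * lyapunov a x := mul_pos (Real.exp_pos _) (Real.exp_pos _)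
    have := le_abs_self B
    linarith
  · rw [Set.indicator_of_notMem hx, mul_zero, add_zero]
    rw [mem_closedBall_zero_iff, not_le, hM, max_lt_iff, max_lt_iff] at hx
    obtain ⟨⟨hx0, hx1⟩, hx2⟩ := hx
    set φ := Real.sqrt (1 + ‖x‖ ^ 2) with hφ
    have hφ0 : 0 < φ := Real.sqrt_pos.2 (by positivity)
    have hφ2 : φ ^ 2 = 1 + ‖x‖ ^ 2 := Real.sq_sqrt (by positivity)
    obtain ⟨h1, h2⟩ := hM₁ ‖x‖ hx1.le
    rw [← hφ] at h1 h2
    -- Far out, `m = √(1 + ‖x‖²)` makes the tangent bound sharp at the current point.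
    have h3 := (integral_lyapunov_eulerKernel_le hc.measurable hγ ha0 hφ0 (by linarith) x).2
    have h4 := hM₀ x hx0.le
    have h5 : a * ((1 + ‖x - γ • T γ x‖ ^ 2 + φ ^ 2) / (2 * φ)) ≤
        a * φ + -(4 * a ^ 2 * γ) * (‖x‖ / φ) := by
      have h6 : a * φ + -(4 * a ^ 2 * γ) * (‖x‖ / φ) =
          a * ((2 * φ ^ 2 - 2 * γ * δ * ‖x‖) / (2 * φ)) := by
        rw [hδa]; field_simp; ring
      rw [h6]
      refine mul_le_mul_of_nonneg_left (div_le_div_of_nonneg_right ?_ (by positivity)) ha0.le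
      linarith
    have h7 : a ^ 2 * γ * ‖x - γ • T γ x‖ ^ 2 / φ ^ 2 ≤ a ^ 2 * γ := by
      refine div_le_of_le_mul₀ (by positivity) (by positivity) ?_
      refine mul_le_mul_of_nonneg_left ?_ (by positivity)
      have : 0 ≤ 2 * γ * δ * ‖x‖ := by positivity
      linarith
    have h8 := div_le_div_of_nonneg_right h7 h2.le
    refine h3.trans ((mul_le_mul (Real.exp_le_exp.2 h5) (mul_le_mul_of_nonneg_left
      (Real.exp_le_exp.2 h8) (Real.rpow_nonneg h2.le _)) (by positivity)
      (Real.exp_pos _).le).trans ?_)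
    rw [Real.exp_add, mul_assoc, mul_comm (Real.exp (-a ^ 2 * γ))]
    exact mul_le_mul_of_nonneg_left h1.le (Real.exp_pos _).le

/-- Sublevel sets of `V_a` are bounded and `H` is continuous, so the means `x - γ H x` stay bounded
there and the Gaussian minorization applies. -/
theorem harrisCondition_eulerKernel (hc : Continuous H) (hγ : 0 < γ) {M a b : ℝ} (ha : 0 < a)
    (hb : 0 < b) (h : ∀ x : EuclideanSpace ℝ (Fin d),
      Integrable (lyapunov a) (eulerKernel γ H hc.measurable x) ∧
        ∫ y, lyapunov a y ∂(eulerKernel γ H hc.measurable x) ≤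
          Real.exp (-a ^ 2 * γ) * lyapunov a x +
            γ * b * (Metric.closedBall (0 : EuclideanSpace ℝ (Fin d)) M).indicator
              (fun _ => (1 : ℝ)) x) :
    HarrisCondition (lyapunov a) (eulerKernel γ H hc.measurable) (Real.exp (-a ^ 2 * γ))
      (γ * b) where
  measurable := (continuous_lyapunov a).measurable
  one_le := one_le_lyapunov ha.le
  rate_nonneg := (Real.exp_pos _).le
  rate_lt_one := by
    rw [Real.exp_lt_one_iff]
    have : 0 < a ^ 2 * γ := by positivity
    linarith
  const_nonneg := by positivity
  integrable x := (h x).1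
  drift x := by
    refine (h x).2.trans (add_le_add_right (mul_le_of_le_one_right (by positivity) ?_) _)
    exact Set.indicator_le_self' (fun _ _ => zero_le_one) x
  minorization r := by
    have hbdd : ∀ x : EuclideanSpace ℝ (Fin d), lyapunov a x ≤ r → ‖x‖ ≤ Real.log r / a := by
      intro x hx
      rw [le_div_iff₀ ha]
      have h1 : ‖x‖ ≤ Real.sqrt (1 + ‖x‖ ^ 2) := Real.le_sqrt_of_sq_le (by linarith)
      have h2 := (Real.le_log_iff_exp_le ((Real.exp_pos _).trans_le hx)).2 hx
      have h3 := mul_le_mul_of_nonneg_left h1 ha.le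
      linarith
    obtain ⟨B, hB⟩ := (isCompact_closedBall (0 : EuclideanSpace ℝ (Fin d))
      (Real.log r / a)).exists_bound_of_continuousOn
      (f := fun x => x - γ • H x) (by fun_prop)
    obtain ⟨η, hη, hη0, hle⟩ := exists_le_map_gaussian (d := d)
      (Real.sqrt_pos.2 (by positivity : 0 < 2 * γ)) B
    exact ⟨η, hη, hη0, fun x hx => hle _ (hB x (mem_closedBall_zero_iff.2 (hbdd x hx)))⟩

end Euler

end TamedEuler

theorem mainTheorem6 {d : ℕ} (U : EuclideanSpace ℝ (Fin d) → ℝ) (hU : ContDiff ℝ 1 U)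
    (T : ℝ → EuclideanSpace ℝ (Fin d) → EuclideanSpace ℝ (Fin d))
    (hH1 : TamedEuler.GradLocLipschitz U)
    (hA1 : TamedEuler.DriftCloseToGrad U T)
    (hA2 : TamedEuler.DriftErgodic T)
    (γ : ℝ) (hγ : 0 < γ) :
    ∃ M a b : ℝ, 0 < M ∧ 0 < a ∧ 0 < b ∧
      (∀ x : EuclideanSpace ℝ (Fin d),
        Integrable (TamedEuler.lyapunov a)
          (TamedEuler.eulerKernel γ (T γ) (hA1.1 γ hγ).measurable x) ∧
        ∫ y, TamedEuler.lyapunov a y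
            ∂(TamedEuler.eulerKernel γ (T γ) (hA1.1 γ hγ).measurable x) ≤
          Real.exp (-a ^ 2 * γ) * TamedEuler.lyapunov a x +
            γ * b * (Metric.closedBall (0 : EuclideanSpace ℝ (Fin d)) M).indicator
              (fun _ => (1 : ℝ)) x) ∧
      ∃ π : Measure (EuclideanSpace ℝ (Fin d)), IsProbabilityMeasure π ∧
        (TamedEuler.eulerKernel γ (T γ) (hA1.1 γ hγ).measurable).Invariant π ∧
        (∀ ν : Measure (EuclideanSpace ℝ (Fin d)), IsProbabilityMeasure ν →
          (TamedEuler.eulerKernel γ (T γ) (hA1.1 γ hγ).measurable).Invariant ν → ν = π) ∧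
        TamedEuler.VGeometricallyErgodic (TamedEuler.lyapunov a)
          (TamedEuler.eulerKernel γ (T γ) (hA1.1 γ hγ).measurable) π := by
  obtain ⟨M, a, b, hM, ha, hb, h⟩ := TamedEuler.exists_lyapunov_drift hA2 hγ (hA1.1 γ hγ)
  exact ⟨M, a, b, hM, ha, hb, h,
    (TamedEuler.harrisCondition_eulerKernel (hA1.1 γ hγ) hγ ha hb
      h).exists_unique_vGeometricallyErgodic⟩
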